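/- Let $N\ge 1$ be an integer (the number of ports), $W>0$ and $\lambda>0$ real numbers and $\kappa\ge 0$ (the Rician factor), and put $A=\sqrt{\kappa/(\kappa+1)}$, $\sigma=\sqrt{1/(\kappa+1)}$. The ports $1,\dots,N$ are equally spaced on a segment of length $W\lambda$, port $n$ lying at distance $l_n=\frac{n-1}{N-1}W\lambda$ from port $1$ ($l_1=0$ if $N=1$), and for $2\le n\le N$ let $\rho_n=J_0(2\pi l_n/\lambda)$, where $J_0$ is the zero-order Bessel function of the first kind. Let $x_0,y_0,x_2,y_2,\dots,x_N,y_N$ be independent real Gaussian random variables with mean $0$ and variance $1/2$, and define the channel coefficients of the Rx-SISO-FAS model by $$h_1=\sigma x_0+j\sigma y_0+A,\qquad h_n=\sigma\bigl(\sqrt{1-\rho_n^2}\,x_n+\rho_n x_0\bigr)+j\sigma\bigl(\sqrt{1-\rho_n^2}\,y_n+\rho_n y_0\bigr)+A\quad(2\le n\le N).$$ Let $|h_{\mathrm{FAS}}|=\max_{1\le n\le N}|h_n|$, and for $\gamma_{th}>0$ let $$p_{out}(\gamma_{th})=P\left(\frac{|h_{\mathrm{FAS}}|^2}{A^2+\sigma^2}<\gamma_{th}\right)$$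 be the outage probability. Then the diversity order is the number of ports: the limit below exists and $$-\lim_{\gamma_{th}\to 0^+}\frac{\log p_{out}(\gamma_{th})}{\log(1/\gamma_{th})}=N.$$ -/

import Mathlib

open MeasureTheory ProbabilityTheory Filter Topology

noncomputable section

namespace FluidAntenna

/-- The zero-order Bessel function of the first kind, by Bessel's integral
`J₀(x) = (1/π) ∫₀^π cos (x sin θ) dθ`. -/
def besselJ0 (x : ℝ) : ℝ :=
  (1 / Real.pi) * ∫ θ in (0 : ℝ)..Real.pi, Real.cos (x * Real.sin θ)

/-- Displacement, from the reference port, of the ports of a uniform linear array of total length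
`W * wl` (`wl` is the carrier wavelength). The index `i : Fin N` is the port number minus one. For
`N = 1` the only port is the reference port and the value is `0`. -/
def displacement (N : ℕ) (W wl : ℝ) (i : Fin N) : ℝ :=
  ((i : ℕ) : ℝ) / ((N : ℝ) - 1) * (W * wl)

/-- Correlation factor between a port and the reference port. -/
def corr (N : ℕ) (W wl : ℝ) (i : Fin N) : ℝ :=
  besselJ0 (2 * Real.pi * (displacement N W wl i / wl))

/-- Amplitude `A` of the line-of-sight path, `A² = κ / (κ + 1)`. -/
def losAmp (κ : ℝ) : ℝ := Real.sqrt (κ / (κ + 1))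

/-- Amplitude `σ` of the scattered paths, `σ² = 1 / (κ + 1)`. -/
def nlosAmp (κ : ℝ) : ℝ := Real.sqrt (1 / (κ + 1))

/-- The small-scale fading coefficient at each port, for an outcome `x, y : Fin N → ℝ` of the
underlying real variables. The entries `x 0, y 0` belong to the reference port and are shared by
all ports; for `i ≠ 0` the entries `x i, y i` are the port's own. -/
def channel (N : ℕ) [NeZero N] (W wl κ : ℝ) (x y : Fin N → ℝ) (i : Fin N) : ℂ :=
  if i = 0 then
    ⟨nlosAmp κ * x 0 + losAmp κ, nlosAmp κ * y 0⟩
  else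
    ⟨nlosAmp κ * (Real.sqrt (1 - corr N W wl i ^ 2) * x i + corr N W wl i * x 0) + losAmp κ,
      nlosAmp κ * (Real.sqrt (1 - corr N W wl i ^ 2) * y i + corr N W wl i * y 0)⟩

/-- Channel gain `|h_FAS|` of the strongest port. -/
def fasGain (N : ℕ) [NeZero N] (W wl κ : ℝ) (x y : Fin N → ℝ) : ℝ :=
  Finset.univ.sup' Finset.univ_nonempty fun i : Fin N => ‖channel N W wl κ x y i‖

/-- Outage probability at the threshold `γ`: the probability that the received SNR of the strongest
port, normalized by the average SNR, is below `γ`. -/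
def outageProb {Ω : Type*} [MeasurableSpace Ω] (μ : Measure Ω) (N : ℕ) [NeZero N] (W wl κ : ℝ)
    (x y : Fin N → Ω → ℝ) (γ : ℝ) : ℝ :=
  μ.real {ω | fasGain N W wl κ (fun i => x i ω) (fun i => y i ω) ^ 2 /
    (losAmp κ ^ 2 + nlosAmp κ ^ 2) < γ}

/-- The outage probability `p`, as a function of the threshold, has diversity order `d`: the limit
of `-log p(γ) / log (1/γ)` as `γ` decreases to `0` exists and equals `d`. -/
def HasDiversityOrder (p : ℝ → ℝ) (d : ℝ) : Prop :=
  Tendsto (fun γ : ℝ => -(Real.log (p γ) / Real.log (1 / γ))) (𝓝[>] 0) (𝓝 d)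

end FluidAntenna

end

open MeasureTheory ProbabilityTheory Filter Topology

namespace FluidAntenna

/-! ### The Bessel correlation factors -/

/-! With `r = √γ`, outage means that all `N` complex coefficients have modulus below `r`. Since
`|ρ_n| < 1` away from the reference port (`abs_corr_lt_one`), the `2N` Gaussian variables and the
`2N` real and imaginary parts determine each other through an invertible triangular affine map.
Hence the outage event lies between two boxes with sides proportional to `r`, centred at the common
zero of all channels (`outage_of_box`, `box_of_outage`).

By independence a box has probability of order `r ^ (2N) = γ ^ N`: the Gaussian density is bounded
above, and bounded below by a positive constant near each centre. The constants disappear in the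
ratio of logarithms (`hasDiversityOrder_of_le_of_le`). -/

lemma abs_besselJ0_lt_one {x : ℝ} (hx : 0 < x) : |besselJ0 x| < 1 := by
  have hc : Continuous fun θ : ℝ => Real.cos (x * Real.sin θ) := by fun_prop
  have hi : IntervalIntegrable (fun θ : ℝ => Real.cos (x * Real.sin θ)) volume 0 Real.pi :=
    hc.intervalIntegrable _ _
  have h1 : 0 < ∫ θ in (0 : ℝ)..Real.pi, (1 + Real.cos (x * Real.sin θ)) := by
    refine intervalIntegral.integral_pos Real.pi_pos (by fun_prop)
      (fun θ _ => by linarith [Real.neg_one_le_cos (x * Real.sin θ)])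
      ⟨0, ⟨le_rfl, Real.pi_pos.le⟩, by simp⟩
  have h2 : 0 < ∫ θ in (0 : ℝ)..Real.pi, (1 - Real.cos (x * Real.sin θ)) := by
    refine intervalIntegral.integral_pos Real.pi_pos (by fun_prop)
      (fun θ _ => by linarith [Real.cos_le_one (x * Real.sin θ)])
      -- At this angle `x * sin θ = x / (1 + x)` lies in `(0, 1)`, where the cosine is strictly
      -- below `1`, however large `x` is.
      ⟨Real.arcsin (1 / (1 + x)), ⟨Real.arcsin_nonneg.2 (by positivity), ?_⟩, ?_⟩
    · linarith [Real.arcsin_le_pi_div_two (1 / (1 + x)), Real.pi_pos]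
    · have h0 : 0 < 1 / (1 + x) := by positivity
      have h3 : 1 / (1 + x) ≤ 1 := by rw [div_le_one (by positivity)]; linarith
      rw [Real.sin_arcsin (by linarith) h3, sub_pos]
      have h4 : x * (1 / (1 + x)) ≤ 1 := by
        rw [mul_one_div, div_le_one (by positivity)]; linarith
      have h5 : 0 < x * (1 / (1 + x)) := by positivity
      have h6 := Real.cos_lt_cos_of_nonneg_of_le_pi le_rfl (by linarith [Real.pi_gt_three]) h5
      rwa [Real.cos_zero] at h6
  rw [intervalIntegral.integral_add (by simp) hi] at h1
  rw [intervalIntegral.integral_sub (by simp) hi] at h2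
  simp only [intervalIntegral.integral_const, sub_zero, smul_eq_mul, mul_one] at h1 h2
  rw [besselJ0, abs_mul, abs_of_pos (one_div_pos.2 Real.pi_pos), one_div_mul_eq_div,
    div_lt_one Real.pi_pos, abs_lt]
  constructor <;> linarith

lemma abs_corr_lt_one {N : ℕ} [NeZero N] {W wl : ℝ} (hW : 0 < W) (hwl : 0 < wl) {i : Fin N}
    (hi : i ≠ 0) : |corr N W wl i| < 1 := by
  have hpos : 0 < (i : ℕ) := Nat.pos_of_ne_zero fun h => hi (Fin.ext h)
  have hN : (1 : ℝ) < N := by exact_mod_cast (by omega : 1 < N)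
  have hi' : (0 : ℝ) < (i : ℕ) := by exact_mod_cast hpos
  have hN' : (0 : ℝ) < N - 1 := by linarith
  apply abs_besselJ0_lt_one
  unfold displacement
  have := Real.pi_pos
  positivity

/-! ### Small boxes under independent Gaussian variables -/

lemma gaussianReal_real_eq_integral (v : NNReal) (hv : v ≠ 0) (s : Set ℝ) :
    (gaussianReal 0 v).real s = ∫ x in s, gaussianPDFReal 0 v x := by
  rw [measureReal_def, gaussianReal_apply_eq_integral 0 hv, ENNReal.toReal_ofReal]
  exact integral_nonneg fun x => gaussianPDFReal_nonneg 0 v x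

lemma continuous_gaussianPDFReal (m : ℝ) (v : NNReal) : Continuous (gaussianPDFReal m v) := by
  unfold gaussianPDFReal
  fun_prop

lemma gaussianPDFReal_le (m : ℝ) (v : NNReal) (x : ℝ) :
    gaussianPDFReal m v x ≤ (√(2 * Real.pi * v))⁻¹ := by
  unfold gaussianPDFReal
  refine mul_le_of_le_one_right (by positivity) (Real.exp_le_one_iff.2 ?_)
  exact div_nonpos_of_nonpos_of_nonneg (by nlinarith [sq_nonneg (x - m)]) (by positivity)

lemma exists_gaussianReal_ball_le (v : NNReal) (hv : v ≠ 0) (c : ℝ) {K : ℝ} (hK : 0 < K) :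
    ∃ C > 0, ∀ r > 0, (gaussianReal 0 v).real {x | |x - c| < K * r} ≤ C * r := by
  have hv' : (0 : ℝ) < v := by exact_mod_cast pos_iff_ne_zero.2 hv
  have := Real.pi_pos
  refine ⟨(√(2 * Real.pi * v))⁻¹ * (2 * K), by positivity, fun r hr => ?_⟩
  have hball : {x : ℝ | |x - c| < K * r} = Metric.ball c (K * r) := rfl
  rw [gaussianReal_real_eq_integral v hv, hball]
  have hvol : volume.real (Metric.ball c (K * r)) = 2 * (K * r) :=
    Real.volume_real_ball (by positivity)
  calc ∫ x in Metric.ball c (K * r), gaussianPDFReal 0 v x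
      ≤ ∫ _ in Metric.ball c (K * r), (√(2 * Real.pi * v))⁻¹ :=
        setIntegral_mono (integrable_gaussianPDFReal 0 v).integrableOn
          (integrableOn_const measure_ball_lt_top.ne) fun x => gaussianPDFReal_le 0 v x
    _ = _ := by rw [setIntegral_const, hvol, smul_eq_mul]; ring

lemma exists_le_gaussianReal_ball (v : NNReal) (hv : v ≠ 0) (c : ℝ) {K : ℝ} (hK : 0 < K) :
    ∃ C > 0, ∀ r > 0, r ≤ 1 → C * r ≤ (gaussianReal 0 v).real {x | |x - c| < K * r} := by
  -- The minimum of the density over the ball of radius `K` serves every `r ≤ 1` at once.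
  obtain ⟨x₀, -, hx₀⟩ := (isCompact_closedBall c K).exists_isMinOn
    (Metric.nonempty_closedBall.2 hK.le) (continuous_gaussianPDFReal 0 v).continuousOn
  have h0 := gaussianPDFReal_pos 0 v x₀ hv
  refine ⟨gaussianPDFReal 0 v x₀ * (2 * K), by positivity, fun r hr hr1 => ?_⟩
  have hball : {x : ℝ | |x - c| < K * r} = Metric.ball c (K * r) := rfl
  rw [gaussianReal_real_eq_integral v hv, hball]
  have hvol : volume.real (Metric.ball c (K * r)) = 2 * (K * r) :=
    Real.volume_real_ball (by positivity)
  calc gaussianPDFReal 0 v x₀ * (2 * K) * r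
      = ∫ _ in Metric.ball c (K * r), gaussianPDFReal 0 v x₀ := by
        rw [setIntegral_const, hvol, smul_eq_mul]; ring
    _ ≤ _ := by
        refine setIntegral_mono_on (integrableOn_const measure_ball_lt_top.ne)
          (integrable_gaussianPDFReal 0 v).integrableOn measurableSet_ball fun x hx => hx₀ ?_
        exact Metric.ball_subset_closedBall (Metric.ball_subset_ball (by nlinarith) hx)

section Box

variable {Ω ι : Type*} [MeasurableSpace Ω] {μ : Measure Ω} [Fintype ι] {v : NNReal}
  {z : ι → Ω → ℝ}

lemma measureReal_box (hz : ∀ i, HasLaw (z i) (gaussianReal 0 v) μ)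
    (hind : iIndepFun z μ) (c R : ι → ℝ) :
    μ.real {ω | ∀ i, |z i ω - c i| < R i} =
      ∏ i, (gaussianReal 0 v).real {x | |x - c i| < R i} := by
  have hm : ∀ i, MeasurableSet {x : ℝ | |x - c i| < R i} := fun i =>
    measurableSet_lt (by fun_prop) measurable_const
  have hset : {ω | ∀ i, |z i ω - c i| < R i} =
      ⋂ i ∈ (Finset.univ : Finset ι), z i ⁻¹' {x | |x - c i| < R i} := by
    ext ω; simp
  rw [hset, measureReal_def, hind.measure_inter_preimage_eq_mul Finset.univ fun i _ => hm i,
    ENNReal.toReal_prod]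
  refine Finset.prod_congr rfl fun i _ => ?_
  rw [measureReal_def, ← (hz i).map_eq,
    Measure.map_apply_of_aemeasurable (hz i).aemeasurable (hm i)]

lemma exists_measureReal_box_le (hv : v ≠ 0) (hz : ∀ i, HasLaw (z i) (gaussianReal 0 v) μ)
    (hind : iIndepFun z μ) (c : ι → ℝ) {K : ι → ℝ} (hK : ∀ i, 0 < K i) :
    ∃ C > 0, ∀ r > 0,
      μ.real {ω | ∀ i, |z i ω - c i| < K i * r} ≤ C * r ^ Fintype.card ι := by
  choose C hC h using fun i => exists_gaussianReal_ball_le v hv (c i) (hK i)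
  refine ⟨∏ i, C i, Finset.prod_pos fun i _ => hC i, fun r hr => ?_⟩
  rw [measureReal_box hz hind c fun i => K i * r, ← Finset.card_univ, ← Finset.prod_const,
    ← Finset.prod_mul_distrib]
  exact Finset.prod_le_prod (fun _ _ => measureReal_nonneg) fun i _ => h i r hr

lemma exists_le_measureReal_box (hv : v ≠ 0) (hz : ∀ i, HasLaw (z i) (gaussianReal 0 v) μ)
    (hind : iIndepFun z μ) (c : ι → ℝ) {K : ι → ℝ} (hK : ∀ i, 0 < K i) :
    ∃ C > 0, ∀ r > 0, r ≤ 1 →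
      C * r ^ Fintype.card ι ≤ μ.real {ω | ∀ i, |z i ω - c i| < K i * r} := by
  choose C hC h using fun i => exists_le_gaussianReal_ball v hv (c i) (hK i)
  refine ⟨∏ i, C i, Finset.prod_pos fun i _ => hC i, fun r hr hr1 => ?_⟩
  rw [measureReal_box hz hind c fun i => K i * r, ← Finset.card_univ, ← Finset.prod_const,
    ← Finset.prod_mul_distrib]
  exact Finset.prod_le_prod (fun i _ => (mul_pos (hC i) hr).le) fun i _ => h i r hr hr1

end Box

/-! ### The outage event lies between two boxes -/

/-- Weight of a port's own variable in its scattered component. -/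
noncomputable def ownWeight (N : ℕ) [NeZero N] (W wl : ℝ) (i : Fin N) : ℝ :=
  if i = 0 then 1 else √(1 - corr N W wl i ^ 2)

/-- Weight of the reference port's variable in the scattered component of the other ports. -/
noncomputable def sharedWeight (N : ℕ) [NeZero N] (W wl : ℝ) (i : Fin N) : ℝ :=
  if i = 0 then 0 else corr N W wl i

/-- The value of a port's own variable for which all scattered components equal `b`. -/
noncomputable def boxCenter (N : ℕ) [NeZero N] (W wl b : ℝ) (i : Fin N) : ℝ :=
  (b - sharedWeight N W wl i * b) / ownWeight N W wl i

section Port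

variable {N : ℕ} [NeZero N] {W wl κ : ℝ}

lemma ownWeight_pos (hW : 0 < W) (hwl : 0 < wl) (i : Fin N) : 0 < ownWeight N W wl i := by
  unfold ownWeight
  split_ifs with hi
  · exact one_pos
  · exact Real.sqrt_pos.2 (sub_pos.2 ((sq_lt_one_iff_abs_lt_one _).2 (abs_corr_lt_one hW hwl hi)))

lemma ownWeight_le_one (i : Fin N) : ownWeight N W wl i ≤ 1 := by
  unfold ownWeight
  split_ifs
  · exact le_rfl
  · exact Real.sqrt_le_one.2 (by nlinarith [sq_nonneg (corr N W wl i)])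

lemma abs_sharedWeight_le_one (hW : 0 < W) (hwl : 0 < wl) (i : Fin N) :
    |sharedWeight N W wl i| ≤ 1 := by
  unfold sharedWeight
  split_ifs with hi
  · simp
  · exact (abs_corr_lt_one hW hwl hi).le

lemma channel_eq (x y : Fin N → ℝ) (i : Fin N) :
    channel N W wl κ x y i =
      ⟨nlosAmp κ * (ownWeight N W wl i * x i + sharedWeight N W wl i * x 0) + losAmp κ,
        nlosAmp κ * (ownWeight N W wl i * y i + sharedWeight N W wl i * y 0)⟩ := by
  unfold channel ownWeight sharedWeight
  split_ifs with hi
  · subst hi; simp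
  · rfl

lemma boxCenter_zero (b : ℝ) : boxCenter N W wl b 0 = b := by
  simp [boxCenter, sharedWeight, ownWeight]

lemma scattered_sub_eq (hW : 0 < W) (hwl : 0 < wl) (b : ℝ) (x : Fin N → ℝ) (i : Fin N) :
    ownWeight N W wl i * x i + sharedWeight N W wl i * x 0 - b =
      ownWeight N W wl i * (x i - boxCenter N W wl b i) +
        sharedWeight N W wl i * (x 0 - b) := by
  have := (ownWeight_pos hW hwl i).ne'
  unfold boxCenter
  field_simp
  ring

lemma abs_scattered_sub_lt (hW : 0 < W) (hwl : 0 < wl) {b t : ℝ} {x : Fin N → ℝ}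
    (h : ∀ i, |x i - boxCenter N W wl b i| < t) (i : Fin N) :
    |ownWeight N W wl i * x i + sharedWeight N W wl i * x 0 - b| < 2 * t := by
  have h0 := h 0
  rw [boxCenter_zero] at h0
  rw [scattered_sub_eq hW hwl]
  calc _ ≤ |ownWeight N W wl i| * |x i - boxCenter N W wl b i| +
        |sharedWeight N W wl i| * |x 0 - b| := by
          rw [← abs_mul, ← abs_mul]; exact abs_add_le _ _
    _ ≤ |x i - boxCenter N W wl b i| + |x 0 - b| := by
        refine add_le_add (mul_le_of_le_one_left (abs_nonneg _) ?_)
          (mul_le_of_le_one_left (abs_nonneg _) (abs_sharedWeight_le_one hW hwl i))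
        rw [abs_of_pos (ownWeight_pos hW hwl i)]
        exact ownWeight_le_one i
    _ < 2 * t := by linarith [h i]

lemma abs_mul_of_pos {a : ℝ} (ha : 0 < a) (b : ℝ) : |a * b| = a * |b| := by
  rw [abs_mul, abs_of_pos ha]

/-- Triangular inversion: port `0` bounds `x 0 - b` directly, and removing its contribution from
another port costs a second `t`. Dividing by the own weight is where `|ρ_n| < 1` is essential. -/
lemma abs_sub_boxCenter_lt (hW : 0 < W) (hwl : 0 < wl) {b t : ℝ} {x : Fin N → ℝ}
    (h : ∀ i, |ownWeight N W wl i * x i + sharedWeight N W wl i * x 0 - b| < t) (i : Fin N) :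
    |x i - boxCenter N W wl b i| < 2 * t / ownWeight N W wl i := by
  have hs := ownWeight_pos hW hwl i
  have h0 : |x 0 - b| < t := by simpa [ownWeight, sharedWeight] using h 0
  have hi := h i
  rw [scattered_sub_eq hW hwl] at hi
  have h1 : |sharedWeight N W wl i * (x 0 - b)| < t := by
    rw [abs_mul]
    exact (mul_le_of_le_one_left (abs_nonneg _) (abs_sharedWeight_le_one hW hwl i)).trans_lt h0
  rw [lt_div_iff₀ hs, mul_comm, ← abs_mul_of_pos hs]
  rw [abs_lt] at *
  constructor <;> linarith

lemma nlosAmp_pos (hκ : 0 ≤ κ) : 0 < nlosAmp κ := Real.sqrt_pos.2 (by positivity)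

lemma losAmp_sq_add_nlosAmp_sq (hκ : 0 ≤ κ) : losAmp κ ^ 2 + nlosAmp κ ^ 2 = 1 := by
  unfold losAmp nlosAmp
  rw [Real.sq_sqrt (by positivity), Real.sq_sqrt (by positivity)]
  field_simp

lemma outage_iff (hκ : 0 ≤ κ) (x y : Fin N → ℝ) {r : ℝ} (hr : 0 < r) :
    fasGain N W wl κ x y ^ 2 / (losAmp κ ^ 2 + nlosAmp κ ^ 2) < r ^ 2 ↔
      ∀ i, ‖channel N W wl κ x y i‖ < r := by
  have h0 : 0 ≤ fasGain N W wl κ x y :=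
    (norm_nonneg (channel N W wl κ x y 0)).trans
      (Finset.le_sup' (fun i => ‖channel N W wl κ x y i‖) (Finset.mem_univ 0))
  rw [losAmp_sq_add_nlosAmp_sq hκ, div_one, sq_lt_sq₀ h0 hr.le, fasGain, Finset.sup'_lt_iff]
  simp

/-- Centre of the boxes around the event that the real (left) and imaginary (right) parts of all
channels vanish. -/
noncomputable def jointCenter (N : ℕ) [NeZero N] (W wl κ : ℝ) : Fin N ⊕ Fin N → ℝ :=
  Sum.elim (boxCenter N W wl (-(losAmp κ / nlosAmp κ))) (boxCenter N W wl 0)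

/-- The line-of-sight term is absorbed into the centre: the real part is `σ * (s - b)` with `s` the
scattered component and `b = -A / σ`. -/
lemma box_of_outage (hW : 0 < W) (hwl : 0 < wl) (hκ : 0 ≤ κ) {x y : Fin N → ℝ} {r : ℝ}
    (h : ∀ i, ‖channel N W wl κ x y i‖ < r) (j : Fin N ⊕ Fin N) :
    |Sum.elim x y j - jointCenter N W wl κ j| <
      2 / (nlosAmp κ * ownWeight N W wl (j.elim id id)) * r := by
  have hσ := nlosAmp_pos hκ
  have key : ∀ i, 2 / (nlosAmp κ * ownWeight N W wl i) * r =
      2 * (r / nlosAmp κ) / ownWeight N W wl i := fun i => by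
    have := (ownWeight_pos hW hwl i).ne'
    field_simp
  rcases j with i | i
  · simp only [Sum.elim_inl, jointCenter, id, key]
    refine abs_sub_boxCenter_lt hW hwl (fun k => ?_) i
    have hk := (Complex.abs_re_le_norm _).trans_lt (h k)
    rw [channel_eq] at hk
    rw [lt_div_iff₀ hσ]
    refine lt_of_eq_of_lt ?_ hk
    rw [mul_comm, ← abs_mul_of_pos hσ]
    congr 1
    field_simp
    ring
  · simp only [Sum.elim_inr, jointCenter, id, key]
    refine abs_sub_boxCenter_lt hW hwl (fun k => ?_) i
    have hk := (Complex.abs_im_le_norm _).trans_lt (h k)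
    rw [channel_eq] at hk
    rw [lt_div_iff₀ hσ]
    refine lt_of_eq_of_lt ?_ hk
    rw [mul_comm, ← abs_mul_of_pos hσ]
    congr 1
    ring

lemma outage_of_box (hW : 0 < W) (hwl : 0 < wl) (hκ : 0 ≤ κ) {x y : Fin N → ℝ} {r : ℝ}
    (h : ∀ j, |Sum.elim x y j - jointCenter N W wl κ j| < 1 / (4 * nlosAmp κ) * r) (i : Fin N) :
    ‖channel N W wl κ x y i‖ < r := by
  have hσ := nlosAmp_pos hκ
  -- The `4` leaves `r / 2` for each of the real and imaginary parts, whose absolute values sum to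
  -- at least the norm.
  have key : 2 * (1 / (4 * nlosAmp κ) * r) = r / 2 / nlosAmp κ := by field_simp; norm_num
  have hre := abs_scattered_sub_lt hW hwl (fun k => h (Sum.inl k)) i
  have him := abs_scattered_sub_lt hW hwl (fun k => h (Sum.inr k)) i
  rw [key, lt_div_iff₀ hσ, mul_comm, ← abs_mul_of_pos hσ] at hre him
  refine (Complex.norm_le_abs_re_add_abs_im _).trans_lt ?_
  have e1 : |(channel N W wl κ x y i).re| < r / 2 := by
    refine lt_of_eq_of_lt ?_ hre
    rw [channel_eq]
    congr 1
    simp only [Sum.elim_inl]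
    field_simp
    ring
  have e2 : |(channel N W wl κ x y i).im| < r / 2 := by
    refine lt_of_eq_of_lt ?_ him
    rw [channel_eq]
    congr 1
    simp only [Sum.elim_inr]
    ring
  linarith

end Port

/-! ### Power bounds determine the diversity order -/

lemma hasDiversityOrder_of_le_of_le {p : ℝ → ℝ} {n : ℕ} {c C : ℝ} (hc : 0 < c) (hC : 0 < C)
    (hl : ∀ γ > 0, γ ≤ 1 → c * γ ^ n ≤ p γ) (hu : ∀ γ > 0, γ ≤ 1 → p γ ≤ C * γ ^ n) :
    HasDiversityOrder p n := by
  have hlim : ∀ a : ℝ, Tendsto (fun γ => a / Real.log γ + n) (𝓝[>] 0) (𝓝 (n : ℝ)) := fun a => by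
    simpa using (Real.tendsto_log_nhdsGT_zero.const_div_atBot a).add_const (n : ℝ)
  refine tendsto_of_tendsto_of_tendsto_of_le_of_le' (hlim (Real.log C)) (hlim (Real.log c)) ?_ ?_
  all_goals
    filter_upwards [Ioo_mem_nhdsGT (one_pos : (0 : ℝ) < 1)] with γ hγ
    have hlog := Real.log_neg hγ.1 hγ.2
    have hpow : 0 < γ ^ n := pow_pos hγ.1 n
    have hp : 0 < p γ := (mul_pos hc hpow).trans_le (hl γ hγ.1 hγ.2.le)
    -- The quantity is `log p / log γ`. As `log γ < 0`, the upper bound on `p` gives the lower bound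
    -- here, and conversely.
    rw [one_div, Real.log_inv, div_neg, neg_neg, div_add' _ _ _ hlog.ne]
    refine div_le_div_of_nonpos_of_le hlog.le ?_
    rw [← Real.log_pow, ← Real.log_mul (by positivity) hpow.ne']
  · exact Real.log_le_log hp (hu γ hγ.1 hγ.2.le)
  · exact Real.log_le_log (by positivity) (hl γ hγ.1 hγ.2.le)

end FluidAntenna

open FluidAntenna

theorem mainTheorem6 {Ω : Type*} [MeasurableSpace Ω] (μ : Measure Ω) [IsProbabilityMeasure μ]
    (N : ℕ) [NeZero N] (W wl κ : ℝ) (hW : 0 < W) (hwl : 0 < wl) (hκ : 0 ≤ κ)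
    (x y : Fin N → Ω → ℝ)
    (hx : ∀ i, HasLaw (x i) (gaussianReal 0 (1 / 2)) μ)
    (hy : ∀ i, HasLaw (y i) (gaussianReal 0 (1 / 2)) μ)
    (hind : iIndepFun (Sum.elim x y) μ) :
    FluidAntenna.HasDiversityOrder (FluidAntenna.outageProb μ N W wl κ x y) (N : ℝ) := by
  have hσ := nlosAmp_pos hκ
  have hz : ∀ j, HasLaw (Sum.elim x y j) (gaussianReal 0 (1 / 2)) μ := by
    rintro (i | i)
    exacts [hx i, hy i]
  have hcomp : ∀ ω j, Sum.elim x y j ω = Sum.elim (fun i => x i ω) (fun i => y i ω) j := by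
    rintro ω (i | i) <;> rfl
  have hpow : ∀ γ > 0, √γ ^ Fintype.card (Fin N ⊕ Fin N) = γ ^ N := fun γ hγ => by
    rw [Fintype.card_sum, Fintype.card_fin, ← two_mul, pow_mul, Real.sq_sqrt hγ.le]
  have hevent : ∀ γ > 0, outageProb μ N W wl κ x y γ =
      μ.real {ω | ∀ i, ‖channel N W wl κ (fun i => x i ω) (fun i => y i ω) i‖ < √γ} :=
    fun γ hγ => by
      unfold outageProb
      congr 1
      ext ω
      have := outage_iff (N := N) (W := W) (wl := wl) hκ (fun i => x i ω) (fun i => y i ω)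
        (Real.sqrt_pos.2 hγ)
      rwa [Real.sq_sqrt hγ.le] at this
  obtain ⟨c, hc, hl⟩ := exists_le_measureReal_box (by simp) hz hind (jointCenter N W wl κ)
    (K := fun _ => 1 / (4 * nlosAmp κ)) fun _ => by positivity
  obtain ⟨C, hC, hu⟩ := exists_measureReal_box_le (by simp) hz hind (jointCenter N W wl κ)
    (K := fun j => 2 / (nlosAmp κ * ownWeight N W wl (j.elim id id))) fun j => by
      have := ownWeight_pos hW hwl (j.elim id id)
      positivity
  refine hasDiversityOrder_of_le_of_le hc hC (fun γ hγ hγ1 => ?_) fun γ hγ _ => ?_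
  · rw [← hpow γ hγ, hevent γ hγ]
    refine (hl √γ (Real.sqrt_pos.2 hγ) (Real.sqrt_le_one.2 hγ1)).trans
      (measureReal_mono fun ω hω => ?_)
    exact outage_of_box hW hwl hκ fun j => hcomp ω j ▸ hω j
  · rw [← hpow γ hγ, hevent γ hγ]
    refine (measureReal_mono fun ω hω j => ?_).trans (hu √γ (Real.sqrt_pos.2 hγ))
    rw [hcomp ω j]
    exact box_of_outage hW hwl hκ hω j
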